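/- **Setting.** Let $V$ be a finite set of nodes; each variable $X_v$ takes values in a standard Borel space. A two-regime model consists of a DAG $G$ on $V$, a target set $I\subseteq V$, and for each regime $c\in\{0,1\}$ a structural causal model $X_v=f^{(c)}_v(X_{\mathrm{pa}_G(v)},U_v)$ with independent noises, such that $f_v$ and the law of $U_v$ agree in both regimes for every $v\notin I$; $P^{(c)}$ is the resulting law of $X_V$. Let $\mathcal M$ be a class of such models, and $\mathcal M(G)$ the set of pairs $(P^{(0)},P^{(1)})$ generated by its members with DAG $G$. Let $\mathcal S_a\neq\varnothing$ be a family of subsets of $V$ and $\mathcal T_a$ a set of pairs $(v,Z)$ with $v\notin Z$, each satisfying $\{v\}\cup Z\subseteq S$ for some $S\in\mathcal S_a$. Let $\mathcal D^{(c)}$ be arbitrary operators sending a law of $X_S$ to a partially directed graph on $S$. Put $E^{(c)}_S=\mathcal D^{(c)}(P^{(c)}_S)$. Write $\mathrm{Inv}(v\mid Z)=1$ if $P^{(0)}(X_v\mid X_Z)=P^{(1)}(X_v\mid X_Z)$ (a common version of the two conditional laws exists), and $\mathrm{Chg}=1-\mathrm{Inv}$. $\mathrm{DirE}(H)$ is the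 set of directed edges of $H$. *Targets.* $[G]_{\mathrm{res}}$ is the set of DAGs $G'$ on $V$ such that the set of tuples $(\{E_S^{(c)}\}_{S\in\mathcal S_a,c},\{\mathrm{Inv}(v\mid Z)\}_{(v,Z)\in\mathcal T_a})$ achieved by $\mathcal M(G')$ equals the set achieved by $\mathcal M(G)$; $[G]_{\mathcal S_a}$ is defined in the same way from the tuples $\{E_S^{(c)}\}$ alone. $G_{\mathrm{test}}$ (resp. $G^{\mathrm{test}}_{\mathcal S_a}$) is the partially directed graph whose adjacencies and whose directed edges are those common to all members of $[G]_{\mathrm{res}}$ (resp. $[G]_{\mathcal S_a}$). Let $R=\mathrm{DirE}(G_{\mathrm{test}})\setminus\mathrm{DirE}(G^{\mathrm{test}}_{\mathcal S_a})$. *Witnesses.* A definite descendant of $v$ in a partially directed graph is a descendant of $v$ in all its consistent DAG extensions (same skeleton and orientations, no new unshielded collider). $\mathcal W(v)$ is the set of $Z$ with $(v,Z)\in\mathcal T_a$ for which some $S\in\mathcal S_a$ contains $\{v\}\cup Z$ and $Z$ contains no definite descendant of $v$ in $E_S^{(0)}$ or in $E_S^{(1)}$. *Contrastive rules* (for $S\in\mathcal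 S_a$). - **SSI** orients $i\to j$ if $i-j$ is undirected in $E^{(0)}_S$ and $E^{(1)}_S$, $i,j$ are adjacent in every $G'\in[G]_{\mathrm{res}}$, and for $Z=S\setminus\{i,j\}$ we have $Z\in\mathcal W(i)\cap\mathcal W(j)$, $\mathrm{Chg}(j\mid Z)=1$, $\mathrm{Inv}(i\mid Z)=1$. - **CVT** orients $i\to j\leftarrow k$ if $i-j-k$ is an unshielded triple in the skeletons of $E^{(0)}_S$ and $E^{(1)}_S$, $i,j$ and $j,k$ are adjacent in every $G'\in[G]_{\mathrm{res}}$, and for $Z=S\setminus\{i,j,k\}$ we have $Z\in\mathcal W(i)\cap\mathcal W(j)\cap\mathcal W(k)$, $\mathrm{Chg}(j\mid Z)=1$, $\mathrm{Inv}(i\mid Z)=\mathrm{Inv}(k\mid Z)=1$. - **DPT** gives an edge $j-k$, undirected in $E^{(0)}_S$ and $E^{(1)}_S$, an orientation $e$ if the following holds. There is a simple path $\pi=\langle v_0,\dots,v_{m-1},j,k\rangle$ in both local skeletons, with $v_0,k$ non-adjacent in both, whose consecutive vertices are adjacent in every $G'\in[G]_{\mathrm{res}}$; a set $\mathcal V\subseteq\{v_1,\dots,v_{m-1}\}$;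 an assignment $\sigma^\star$ to each $v\in\mathcal V$ of a status ($v$ is / is not a collider on $\pi$; $v$ is / is not a parent of $k$); and $Z\subseteq S$ with $Z\in\mathcal W(j)\cap\bigcap_{v\in\mathcal V}\mathcal W(v)$, $\mathrm{Chg}(j\mid Z)=1$ and $\mathrm{Inv}(v\mid Z)=1$ for $v\in\mathcal V$. Call a DAG compatible if it contains the adjacencies of $\pi$ and those directed edges of $E_S^{(0)}$, $E_S^{(1)}$ that lie in $\mathrm{DirE}(G_{\mathrm{test}})$. Then all compatible DAGs with statuses $\sigma^\star$ contain $e$, but not all compatible DAGs do. Finally, consider any model in $\mathcal M$ whose DAG $G'$ lies in $[G]_{\mathrm{res}}$ and does not contain $e$, with target set $I'$ and the same tuple of local PDAGs and tested invariances as the observed one; let $r\in\mathcal V$ be the first node, going from $j$ to $v_0$, whose status in $G'$ differs from $\sigma^\star$ (if there is one). Then, in $G'$ augmented by a node $C$ with arrows $C\to t$, $t\in I'$, the segment of $\pi$ from $r$ to $j$ is unblocked given $Z$ and has a tail at $j\notin Z$, and some path from $C$ to $j$ unblocked given $Z$ meets the segment only at $j$. *Aggregation.* For a partially directed graph $H$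 and a set $K$ of ordered pairs, $\mathrm{MPDAG}(H\mid K)$ is obtained from $H$ by orienting its undirected edges according to $K$ and closing under Meek's four rules. Let $H_{\mathrm{obs}}$ be any partially directed graph on $V$ (the output of an observational discovery algorithm), $\mathcal K_{\mathrm{per}}=\mathrm{DirE}(G^{\mathrm{test}}_{\mathcal S_a})$, and $\mathcal K_{\mathrm{rules}}$ the set of all directed edges output by SSI, CVT and DPT on the sets $S\in\mathcal S_a$. Put $H_{\mathrm{per}}=\mathrm{MPDAG}(H_{\mathrm{obs}}\mid\mathcal K_{\mathrm{per}})$ and $H_{\mathrm{ctr}}=\mathrm{MPDAG}(H_{\mathrm{obs}}\mid\mathcal K_{\mathrm{per}}\cup\mathcal K_{\mathrm{rules}})$. A non-contrastive, subset-respecting aggregator is a map $\mathcal A$ from families of local PDAGs to partially directed graphs on $V$ that is invariant under swapping the two regimes and satisfies $\mathrm{DirE}(\mathcal A)\subseteq\mathrm{DirE}(H_{\mathrm{per}})$ at the observed family. **Theorem.** Let the observed pair $(P^{(0)},P^{(1)})$ be generated by a model in $\mathcal M$ with DAG $G$. Assume: - *(regime faithfulness)* for every model in $\mathcal M$, with DAG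 $G'$ and targets $I'$, and every $(v,Z)\in\mathcal T_a$ with $Z\in\mathcal W(v)$: $C$ and $v$ are d-separated by $Z$ in $(V\cup\{C\},\,E(G')\cup\{C\to t:t\in I'\})$ if and only if $C$ and $X_v$ are conditionally independent given $X_Z$ under $P^*(C=c,X)=\pi_cP^{(c)}(X)$, where $\pi_0,\pi_1>0$, $\pi_0+\pi_1=1$ are fixed; - *(closure soundness)* if $\mathrm{DirE}(H_{\mathrm{obs}})$ and $K$ are contained in $\mathrm{DirE}(G_{\mathrm{test}})$, then $\mathrm{DirE}(\mathrm{MPDAG}(H_{\mathrm{obs}}\mid K))\subseteq\mathrm{DirE}(G_{\mathrm{test}})$; - $\mathrm{DirE}(H_{\mathrm{per}})\subseteq\mathrm{DirE}(G^{\mathrm{test}}_{\mathcal S_a})$. Then 1. $\mathrm{DirE}(H_{\mathrm{obs}})\subseteq\mathrm{DirE}(H_{\mathrm{per}})\subseteq\mathrm{DirE}(H_{\mathrm{ctr}})$; 2. $\mathrm{DirE}(H_{\mathrm{ctr}})\subseteq\mathrm{DirE}(G_{\mathrm{test}})$; 3. if $R\neq\varnothing$, then $\mathrm{DirE}(\mathcal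 A)\subsetneq\mathrm{DirE}(G_{\mathrm{test}})$ for every non-contrastive, subset-respecting aggregator $\mathcal A$ (in particular for every sound one), and $\mathrm{DirE}(H_{\mathrm{per}})\subsetneq\mathrm{DirE}(G_{\mathrm{test}})$. -/

import Mathlib

open MeasureTheory ProbabilityTheory
open scoped NNReal ENNReal

/-! ### Directed acyclic graphs and d-separation -/

/-- A directed acyclic graph on `W`: `D.Adj u v` is the arrow `u → v`. -/
structure DAG (W : Type*) extends Digraph W where
  acyclic : ∀ v, ¬ Relation.TransGen Adj v v

namespace DAG

variable {W : Type*}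

/-- Adjacency in the skeleton. -/
def Skel (D : DAG W) (u v : W) : Prop := D.Adj u v ∨ D.Adj v u

/-- `De_D(v)`, with `v` counted as a descendant of itself. -/
def descendants (D : DAG W) (v : W) : Set W := {w | Relation.ReflTransGen D.Adj v w}

/-- `b` is a collider between its path neighbours `a` and `c`. -/
def IsCollider (D : DAG W) (a b c : W) : Prop := D.Adj a b ∧ D.Adj c b

/-- The simple path `l` (list of its vertices) is unblocked given `Z`: each internal collider
has a descendant (possibly itself) in `Z`, and no internal non-collider lies in `Z`. -/
structure IsUnblocked (D : DAG W) (Z : Set W) (l : List W) : Prop where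
  nodup : l.Nodup
  chain : l.IsChain D.Skel
  collider : ∀ a b c, [a, b, c] <:+: l → D.IsCollider a b c → (D.descendants b ∩ Z).Nonempty
  noncollider : ∀ a b c, [a, b, c] <:+: l → ¬ D.IsCollider a b c → b ∉ Z

/-- d-connection of `a` and `b` given `Z`. -/
def DConnected (D : DAG W) (a b : W) (Z : Set W) : Prop :=
  ∃ l : List W, l.head? = some a ∧ l.getLast? = some b ∧ D.IsUnblocked Z l

/-- d-separation of `a` and `b` given `Z`. -/
def DSep (D : DAG W) (a b : W) (Z : Set W) : Prop := ¬ D.DConnected a b Z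

/-- Arrows of the graph obtained by adding the regime node `C = none` with arrows `C → t` for
`t ∈ I`. -/
def AugAdj (D : DAG W) (I : Set W) : Option W → Option W → Prop
  | some u, some v => D.Adj u v
  | none, some t => t ∈ I
  | _, none => False

theorem transGen_augAdj_some (D : DAG W) (I : Set W) (u : W) (y : Option W)
    (h : Relation.TransGen (D.AugAdj I) (some u) y) :
    ∃ v, y = some v ∧ Relation.TransGen D.Adj u v := by
  induction h with
  | @single y h =>
    rcases y with _ | v
    · exact False.elim h
    · exact ⟨v, rfl, Relation.TransGen.single h⟩
  | @tail y z _ h ih =>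
    obtain ⟨w, rfl, hw⟩ := ih
    rcases z with _ | v
    · exact False.elim h
    · exact ⟨v, rfl, hw.tail h⟩

theorem not_transGen_augAdj_none (D : DAG W) (I : Set W) (x : Option W) :
    ¬ Relation.TransGen (D.AugAdj I) x none := by
  intro h
  obtain ⟨b, -, h⟩ := Relation.TransGen.tail'_iff.1 h
  rcases b with _ | v <;> exact h

/-- The augmented graph `G* = (V ∪ {C}, E ∪ {C → t : t ∈ I})`, with `C = none`. -/
def augmented (D : DAG W) (I : Set W) : DAG (Option W) where
  Adj := D.AugAdj I
  acyclic := by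
    rintro (_ | v) h
    · exact D.not_transGen_augAdj_none I _ h
    · obtain ⟨w, hw, h'⟩ := D.transGen_augAdj_some I v _ h
      cases hw
      exact D.acyclic v h'

end DAG

/-! ### Partially directed graphs -/

/-- A partially directed graph: a skeleton, some of whose edges carry an orientation.
Acyclicity of the directed part is not imposed, so everything below holds in particular for
partially directed acyclic graphs. -/
structure PDAG (W : Type*) where
  skel : SimpleGraph W
  dir : W → W → Prop
  dir_adj : ∀ {u v}, dir u v → skel.Adj u v

namespace PDAG

variable {W : Type*}

/-- The set of directed edges; `(u, v)` stands for `u → v`. -/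
def DirE (H : PDAG W) : Set (W × W) := {e | H.dir e.1 e.2}

/-- `u - v` is an undirected edge. -/
def Undir (H : PDAG W) (u v : W) : Prop := H.skel.Adj u v ∧ ¬ H.dir u v ∧ ¬ H.dir v u

/-- `D` is a (consistent) DAG extension of `H`: same skeleton, same orientations where `H` is
oriented, and no unshielded collider that is not already one in `H`. -/
structure IsExtension (H : PDAG W) (D : DAG W) : Prop where
  skel_iff : ∀ u v, D.Skel u v ↔ H.skel.Adj u v
  dir_sub : ∀ u v, H.dir u v → D.Adj u v
  collider : ∀ a b c, a ≠ c → D.IsCollider a b c → ¬ D.Skel a c → H.dir a b ∧ H.dir c b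

/-- Definite descendants of `v`: descendants of `v` in all DAG extensions. -/
def definiteDescendants (H : PDAG W) (v : W) : Set W :=
  {w | ∀ D : DAG W, H.IsExtension D → w ∈ D.descendants v}

/-- The partially directed graph on `V` with the edges of a graph on a subset `S`. -/
def onSuperset {V : Type*} {S : Finset V} (E : PDAG S) : PDAG V where
  skel := E.skel.map (Function.Embedding.subtype _)
  dir := Relation.Map E.dir Subtype.val Subtype.val
  dir_adj := by
    rintro _ _ ⟨a, b, h, rfl, rfl⟩
    exact (SimpleGraph.map_adj _ _ _ _).2 ⟨a, b, E.dir_adj h, rfl, rfl⟩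

/-- Arrows obtained from `H` by orienting its undirected edges according to the background
knowledge `K` and closing under the four Meek rules. -/
inductive MeekArrow (H : PDAG W) (K : Set (W × W)) : W → W → Prop
  | base {u v} : H.dir u v → MeekArrow H K u v
  | knowledge {u v} : (u, v) ∈ K → H.Undir u v → MeekArrow H K u v
  | rule1 {a b c} : MeekArrow H K a b → H.Undir b c → a ≠ c → ¬ H.skel.Adj a c →
      MeekArrow H K b c
  | rule2 {a b c} : MeekArrow H K a b → MeekArrow H K b c → H.Undir a c → MeekArrow H K a c
  | rule3 {a b c d} : H.Undir a b → H.Undir a c → H.Undir a d → MeekArrow H K c b →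
      MeekArrow H K d b → c ≠ d → ¬ H.skel.Adj c d → MeekArrow H K a b
  | rule4 {a b c d} : H.Undir a b → H.skel.Adj a c → H.Undir a d → MeekArrow H K d c →
      MeekArrow H K c b → d ≠ b → ¬ H.skel.Adj d b → MeekArrow H K a b

theorem MeekArrow.adj {H : PDAG W} {K : Set (W × W)} {u v : W} (h : H.MeekArrow K u v) :
    H.skel.Adj u v := by
  induction h with
  | base h => exact H.dir_adj h
  | knowledge _ h => exact h.1
  | rule1 _ h => exact h.1
  | rule2 _ _ h => exact h.1
  | rule3 h => exact h.1
  | rule4 h => exact h.1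

/-- `MPDAG(H subject to K)`: the Meek closure of `H` under the background knowledge `K`. -/
def mpdag (H : PDAG W) (K : Set (W × W)) : PDAG W where
  skel := H.skel
  dir := H.MeekArrow K
  dir_adj := MeekArrow.adj

end PDAG

/-- The partially directed graph whose skeleton and whose orientations are those common to all
members of a class of DAGs. -/
def essentialGraph {V : Type*} (cls : Set (DAG V)) : PDAG V where
  skel :=
    { Adj := fun u v => u ≠ v ∧ ∀ D ∈ cls, D.Skel u v
      symm := ⟨fun _ _ h => ⟨h.1.symm, fun D hD => (h.2 D hD).symm⟩⟩
      loopless := ⟨fun _ h => h.1 rfl⟩ }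
  dir := fun u v => u ≠ v ∧ ∀ D ∈ cls, D.Adj u v
  dir_adj := fun h => ⟨h.1, fun D hD => Or.inl (h.2 D hD)⟩

/-! ### Two-regime models -/

/-- A two-regime modular soft-intervention structural causal model on a fixed DAG.
In regime `c`, `X_v = mech c v (X_{pa(v)}, U_v)` with independent noises `U_v ∼ noise c v`;
mechanisms and noise laws agree across regimes outside the intervention targets. -/
structure TwoRegimeSCM (V : Type*) [Fintype V] (𝓧 : V → Type*)
    [∀ v, MeasurableSpace (𝓧 v)] where
  graph : DAG V
  targets : Set V
  noise : Fin 2 → V → Measure ℝ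
  noise_prob : ∀ c v, IsProbabilityMeasure (noise c v)
  mech : Fin 2 → (v : V) → ((w : {w // graph.Adj w v}) → 𝓧 w) → ℝ → 𝓧 v
  measurable_mech : ∀ c v, Measurable (Function.uncurry (mech c v))
  modular : ∀ v, v ∉ targets → mech 0 v = mech 1 v ∧ noise 0 v = noise 1 v
  /-- The solution of the structural equations, unique because the graph is acyclic. -/
  sol : Fin 2 → (V → ℝ) → (v : V) → 𝓧 v
  measurable_sol : ∀ c, Measurable (sol c)
  sol_eq : ∀ c u v, sol c u v = mech c v (fun w => sol c u w) (u v)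

namespace TwoRegimeSCM

variable {V : Type*} [Fintype V] {𝓧 : V → Type*} [∀ v, MeasurableSpace (𝓧 v)]

/-- The distribution `P^(c)` of `X_V` in regime `c`. -/
noncomputable def P (m : TwoRegimeSCM V 𝓧) (c : Fin 2) : Measure ((v : V) → 𝓧 v) :=
  (Measure.pi (m.noise c)).map (m.sol c)

instance isProbabilityMeasure_P (m : TwoRegimeSCM V 𝓧) (c : Fin 2) :
    IsProbabilityMeasure (m.P c) :=
  have := m.noise_prob c
  Measure.isProbabilityMeasure_map (m.measurable_sol c).aemeasurable

/-- `Inv(v ∣ Z)`: the conditional distributions of `X_v` given `X_Z` agree in the two regimes,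
that is, one kernel is a version of both. -/
def Inv (m : TwoRegimeSCM V 𝓧) (v : V) (Z : Finset V) : Prop :=
  ∃ κ : Kernel ((w : Z) → 𝓧 w) (𝓧 v), IsMarkovKernel κ ∧
    ∀ c, (m.P c).map (fun x => (Z.restrict x, x v)) = ((m.P c).map Z.restrict) ⊗ₘ κ

/-- The mixture `P*(C = c, X) = π_c P^(c)(X)`. -/
noncomputable def mixture (m : TwoRegimeSCM V 𝓧) (w : Fin 2 → ℝ≥0) :
    Measure (Fin 2 × ((v : V) → 𝓧 v)) :=
  w 0 • (Measure.dirac 0).prod (m.P 0) + w 1 • (Measure.dirac 1).prod (m.P 1)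

instance isFiniteMeasure_mixture (m : TwoRegimeSCM V 𝓧) (w : Fin 2 → ℝ≥0) :
    IsFiniteMeasure (m.mixture w) := by
  unfold mixture; infer_instance

/-- `C ⫫ X_v ∣ X_Z` under `P*`. -/
def RegimeCondIndep [∀ v, StandardBorelSpace (𝓧 v)] (m : TwoRegimeSCM V 𝓧)
    (w : Fin 2 → ℝ≥0) (v : V) (Z : Finset V) : Prop :=
  CondIndepFun
    (MeasurableSpace.comap
      (fun p : Fin 2 × ((v : V) → 𝓧 v) => (Z.restrict p.2 : (w : Z) → 𝓧 w)) inferInstance)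
    (Measurable.comap_le (by fun_prop))
    (fun p : Fin 2 × ((v : V) → 𝓧 v) => p.1) (fun p => p.2 v) (m.mixture w)

/-- `C ⊥_d v ∣ Z` in the augmented graph. -/
def RegimeDSep (m : TwoRegimeSCM V 𝓧) (v : V) (Z : Finset V) : Prop :=
  (m.graph.augmented m.targets).DSep none (some v) (some '' (Z : Set V))

end TwoRegimeSCM

/-! ### Testing families, images and equivalence classes -/

/-- An admissible testing family `(S_a, T_a)`. -/
structure TestingFamily (V : Type*) where
  Sa : Set (Finset V)
  Ta : Set (V × Finset V)
  nonempty : Sa.Nonempty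
  not_mem : ∀ q ∈ Ta, q.1 ∉ q.2
  supported : ∀ q ∈ Ta, ∃ S ∈ Sa, q.1 ∈ S ∧ q.2 ⊆ S

/-- Within-regime discovery operators `𝒟^(c)`, applied to distributions of `X_S`. -/
abbrev Discovery (V : Type*) (𝓧 : V → Type*) [∀ v, MeasurableSpace (𝓧 v)] :=
  Fin 2 → (S : Finset V) → Measure ((v : S) → 𝓧 v) → PDAG S

/-- Families `{E_S^(c)}` of local PDAGs. -/
abbrev LocalPDAGs {V : Type*} (F : TestingFamily V) := Fin 2 → (S : F.Sa) → PDAG S.1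

section Classes

variable {V : Type*} [Fintype V] {𝓧 : V → Type*} [∀ v, MeasurableSpace (𝓧 v)]
  (M : Set (TwoRegimeSCM V 𝓧)) (F : TestingFamily V) (𝒟 : Discovery V 𝓧)

/-- The population local PDAGs `E_S^(c) = 𝒟^(c)(P_S^(c))`. -/
noncomputable def localPDAGs (m : TwoRegimeSCM V 𝓧) : LocalPDAGs F :=
  fun c S => 𝒟 c S.1 ((m.P c).map S.1.restrict)

/-- The outcomes of all queries: local PDAGs and tested invariance literals. -/
noncomputable def outcome (m : TwoRegimeSCM V 𝓧) : LocalPDAGs F × (F.Ta → Prop) :=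
  (localPDAGs F 𝒟 m, fun q => m.Inv q.1.1 q.1.2)

/-- The restricted `Ψ`-image of `G`. -/
def psiImage (G : DAG V) : Set (LocalPDAGs F × (F.Ta → Prop)) :=
  {t | ∃ m ∈ M, m.graph = G ∧ outcome F 𝒟 m = t}

/-- The reduced `Ψ`-image of `G`, without invariance queries. -/
def reducedPsiImage (G : DAG V) : Set (LocalPDAGs F) :=
  {t | ∃ m ∈ M, m.graph = G ∧ localPDAGs F 𝒟 m = t}

/-- The restricted `Ψ`-equivalence class `[G]_res`. -/
def resClass (G : DAG V) : Set (DAG V) := {G' | psiImage M F 𝒟 G' = psiImage M F 𝒟 G}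

/-- The reduced equivalence class of `G`. -/
def reducedClass (G : DAG V) : Set (DAG V) :=
  {G' | reducedPsiImage M F 𝒟 G' = reducedPsiImage M F 𝒟 G}

/-- The test-induced essential graph `G_test(G)`. -/
def Gtest (G : DAG V) : PDAG V := essentialGraph (resClass M F 𝒟 G)

/-- The reduced test-induced essential graph `G_{S_a}^test(G)`. -/
def GtestReduced (G : DAG V) : PDAG V := essentialGraph (reducedClass M F 𝒟 G)

/-- `R`: directed edges compelled in `G_test` but not in `G_{S_a}^test`. -/
def contrastivelyCompelled (G : DAG V) : Set (V × V) :=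
  (Gtest M F 𝒟 G).DirE \ (GtestReduced M F 𝒟 G).DirE

variable {F}

/-- The admissible witness family `𝒲(v)`. -/
def witnesses (E : LocalPDAGs F) (v : V) : Set (Finset V) :=
  {Z | (v, Z) ∈ F.Ta ∧ ∃ S : F.Sa, ∃ hv : v ∈ S.1, Z ⊆ S.1 ∧
    ∀ c, ∀ z : S.1, z.1 ∈ Z → z ∉ (E c S).definiteDescendants ⟨v, hv⟩}

variable (F)

/-- Regime faithfulness on tested witnesses, for one model and mixture weights `w`. -/
def RegimeFaithful [∀ v, StandardBorelSpace (𝓧 v)] (w : Fin 2 → ℝ≥0)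
    (m : TwoRegimeSCM V 𝓧) : Prop :=
  ∀ v Z, (v, Z) ∈ F.Ta → Z ∈ witnesses (localPDAGs F 𝒟 m) v →
    (m.RegimeDSep v Z ↔ m.RegimeCondIndep w v Z)

end Classes

/-! ### Contrastive orientation rules -/

section Rules

variable {V : Type*} [Fintype V] [DecidableEq V] {𝓧 : V → Type*}
  [∀ v, MeasurableSpace (𝓧 v)]
  (M : Set (TwoRegimeSCM V 𝓧)) (F : TestingFamily V) (𝒟 : Discovery V 𝓧)
  (m : TwoRegimeSCM V 𝓧)

/-- The local PDAG `E_S^(c)`, with its edges regarded as edges between elements of `V`. -/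
noncomputable def localOn (c : Fin 2) (S : F.Sa) : PDAG V := (localPDAGs F 𝒟 m c S).onSuperset

/-- `(v, Z)` is a tested query and `Z` is an admissible witness for `v`. -/
def TestedWitness (v : V) (Z : Finset V) : Prop :=
  (v, Z) ∈ F.Ta ∧ Z ∈ witnesses (localPDAGs F 𝒟 m) v

/-- Single-sided invariance orients `i → j`. -/
structure SSI (S : F.Sa) (i j : V) : Prop where
  undir : ∀ c, (localOn F 𝒟 m c S).Undir i j
  witness_i : TestedWitness F 𝒟 m i (S.1 \ {i, j})
  witness_j : TestedWitness F 𝒟 m j (S.1 \ {i, j})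
  skel : ∀ G' ∈ resClass M F 𝒟 m.graph, G'.Skel i j
  chg : ¬ m.Inv j (S.1 \ {i, j})
  inv : m.Inv i (S.1 \ {i, j})

/-- The contrastive v-structure rule orients `i → j ← k`. -/
structure CVT (S : F.Sa) (i j k : V) : Prop where
  ne : i ≠ k
  adj_ij : ∀ c, (localOn F 𝒟 m c S).skel.Adj i j
  adj_jk : ∀ c, (localOn F 𝒟 m c S).skel.Adj j k
  unshielded : ∀ c, ¬ (localOn F 𝒟 m c S).skel.Adj i k
  witness_i : TestedWitness F 𝒟 m i (S.1 \ {i, j, k})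
  witness_j : TestedWitness F 𝒟 m j (S.1 \ {i, j, k})
  witness_k : TestedWitness F 𝒟 m k (S.1 \ {i, j, k})
  skel_ij : ∀ G' ∈ resClass M F 𝒟 m.graph, G'.Skel i j
  skel_jk : ∀ G' ∈ resClass M F 𝒟 m.graph, G'.Skel j k
  chg : ¬ m.Inv j (S.1 \ {i, j, k})
  inv_i : m.Inv i (S.1 \ {i, j, k})
  inv_k : m.Inv k (S.1 \ {i, j, k})

/-- The local discriminating-path status of the node `v` on the path `l` with respect to `k`:
whether `v` is a collider on `l`, and whether `v` is a parent of `k`. -/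
def pathStatus (D : DAG V) (l : List V) (k v : V) : Prop × Prop :=
  (∃ a b, [a, v, b] <:+: l ∧ D.IsCollider a v b, D.Adj v k)

/-- Endpoint marks already known on `S`: orientations of the local PDAGs that are valid throughout
the restricted equivalence class. -/
def knownMarks (S : F.Sa) : Set (V × V) :=
  {e | (∃ c, e ∈ (localOn F 𝒟 m c S).DirE) ∧ e ∈ (Gtest M F 𝒟 m.graph).DirE}

/-- `D` is compatible with the path `l` and the known marks `K`. -/
def AmbientCompatible (K : Set (V × V)) (l : List V) (D : DAG V) : Prop :=
  l.IsChain D.Skel ∧ ∀ e ∈ K, D.Adj e.1 e.2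

/-- The contrastive discriminating-path rule orients the edge `{j, k}` as `e`, on the path
`π = ⟨v_0, …, v_{m-1}, j, k⟩` with `p = ⟨v_0, …, v_{m-1}⟩`, replay nodes `R`, target replay
assignment `σ` and witness `Z`. -/
structure DPT (S : F.Sa) (v0 : V) (p : List V) (j k : V) (R : Set V) (σ : V → Prop × Prop)
    (Z : Finset V) (e : V × V) : Prop where
  mark : e = (j, k) ∨ e = (k, j)
  undir : ∀ c, (localOn F 𝒟 m c S).Undir j k
  -- a candidate discriminating path common to both local skeletons
  head : p.head? = some v0
  nodup : (p ++ [j, k]).Nodup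
  path : ∀ c, (p ++ [j, k]).IsChain (localOn F 𝒟 m c S).skel.Adj
  nonadj : ∀ c, ¬ (localOn F 𝒟 m c S).skel.Adj v0 k
  replay : ∀ v ∈ R, v ∈ p.tail
  -- the mark is not determined without the replay statuses, and it is determined by `σ`
  prevented : ∃ D : DAG V,
    AmbientCompatible (knownMarks M F 𝒟 m S) (p ++ [j, k]) D ∧ ¬ D.Adj e.1 e.2
  determined : ∀ D : DAG V, AmbientCompatible (knownMarks M F 𝒟 m S) (p ++ [j, k]) D →
    (∀ v ∈ R, pathStatus D (p ++ [j, k]) k v = σ v) → D.Adj e.1 e.2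
  -- the tested contrastive literals
  witness_sub : Z ⊆ S.1
  witness_j : TestedWitness F 𝒟 m j Z
  witness_replay : ∀ v ∈ R, TestedWitness F 𝒟 m v Z
  inv : ∀ v ∈ R, m.Inv v Z
  chg : ¬ m.Inv j Z
  -- the path is in the common skeleton of the equivalence class
  skel : ∀ G' ∈ resClass M F 𝒟 m.graph, (p ++ [j, k]).IsChain G'.Skel
  -- whenever a member of the class carries the other mark, through replay statuses whose first
  -- disagreement with `σ`, going from `j` towards `v_0`, is at `r`, the segment from `r` to `j` is
  -- unblocked with a tail at `j`, and some unblocked path from `C` to `j` meets it only at `j`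
  alternative : ∀ m' ∈ M, m'.graph ∈ resClass M F 𝒟 m.graph → outcome F 𝒟 m' = outcome F 𝒟 m →
    ¬ m'.graph.Adj e.1 e.2 →
    ∀ pre r mid, p = pre ++ r :: mid → r ∈ R →
      pathStatus m'.graph (p ++ [j, k]) k r ≠ σ r →
      (∀ u ∈ mid, u ∈ R → pathStatus m'.graph (p ++ [j, k]) k u = σ u) →
      (m'.graph.augmented m'.targets).IsUnblocked (some '' (Z : Set V))
        ((r :: mid ++ [j]).map some) ∧
      (∀ x, [x, j] <:+ r :: mid ++ [j] → m'.graph.Adj j x) ∧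
      j ∉ Z ∧
      ∃ q : List (Option V), q.head? = some none ∧ q.getLast? = some (some j) ∧
        (m'.graph.augmented m'.targets).IsUnblocked (some '' (Z : Set V)) q ∧
        ∀ u ∈ r :: mid ++ [j], some u ∈ q → u = j

/-- `ContR`: the directed edges output on `S` by the contrastive orientation rules. -/
def ContR (S : F.Sa) : Set (V × V) :=
  {e | SSI M F 𝒟 m S e.1 e.2} ∪
  {e | ∃ i j k, CVT M F 𝒟 m S i j k ∧ (e = (i, j) ∨ e = (k, j))} ∪
  {e | ∃ v0 p j k R σ Z, DPT M F 𝒟 m S v0 p j k R σ Z e}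

/-! ### Knowledge sets and aggregation -/

/-- The per-regime background knowledge `K_per`. -/
def Kper : Set (V × V) := (GtestReduced M F 𝒟 m.graph).DirE

/-- The contrastive-rule background knowledge `K_rules`. -/
def Krules : Set (V × V) := ⋃ S : F.Sa, ContR M F 𝒟 m S

/-- `H_per = MPDAG(H_obs subject to K_per)`. -/
def Hper (Hobs : PDAG V) : PDAG V := Hobs.mpdag (Kper M F 𝒟 m)

/-- `H_ctr = MPDAG(H_obs subject to K_per ∪ K_rules)`. -/
def Hctr (Hobs : PDAG V) : PDAG V := Hobs.mpdag (Kper M F 𝒟 m ∪ Krules M F 𝒟 m)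

end Rules

/-- Closure soundness: if all directed constraints (those of `H` and the background knowledge `K`)
are directed edges of the target, then the closure orients only directed edges of the target. -/
def ClosureSound {V : Type*} (H target : PDAG V) : Prop :=
  ∀ K : Set (V × V), H.DirE ⊆ target.DirE → K ⊆ target.DirE → (H.mpdag K).DirE ⊆ target.DirE

/-- The map `A` on families of local PDAGs is a non-contrastive, subset-respecting aggregator for
the observed family `E`, with per-regime aggregation `Hp`: its directed edges on `E` are among those
of `Hp`, and it is invariant under swapping the regime labels. -/
structure NonContrastive {V : Type*} {F : TestingFamily V} (A : LocalPDAGs F → PDAG V)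
    (E : LocalPDAGs F) (Hp : PDAG V) : Prop where
  dirE_subset : (A E).DirE ⊆ Hp.DirE
  swap_invariant : ∀ E' : LocalPDAGs F, A (fun c => E' (Equiv.swap 0 1 c)) = A E'

/-! Part 1 is monotonicity of the Meek closure in the background knowledge. For part 2, closure
soundness reduces the claim to `Kper` and `Krules` lying in the directed part of `Gtest`. The first
holds because a reduced image is a projection of the full one, so the restricted class is contained
in the reduced class. For the second, every DAG in the restricted class carries a model with exactly
the observed outcome. In that model a tested invariance says that the regime node `C` is
conditionally independent of the variable (`inv_iff_regimeCondIndep`), hence, by faithfulness,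
d-separated from it. A wrongly oriented edge would extend a d-connection from `C` to the changing
node as far as an invariant one: along a single arrow for SSI and CVT (`DConnected.of_adj`), along a
path segment for DPT (`DConnected.of_segment`). Part 3 follows because an edge of `R` is in `Gtest`
but outside the reduced graph, which bounds `Hper` and therefore every aggregator. -/

/-! ### Unblocked paths -/

namespace List

variable {α : Type*}

/-- Blocking is a condition on consecutive triples, so gluing two paths at `b` creates only one
triple to check, the one centred at `b`. -/
theorem triple_infix_append_cons {a c d b : α} {q s : List α}
    (h : [a, c, d] <:+: q ++ b :: s) :
    [a, c, d] <:+: q ++ [b] ∨ [a, c, d] <:+: b :: s ∨ (c = b ∧ s.head? = some d) := by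
  induction q with
  | nil => exact Or.inr (Or.inl h)
  | cons x q ih =>
    rw [cons_append, infix_cons_iff] at h
    rcases h with h | h
    · rw [cons_prefix_cons] at h
      obtain ⟨rfl, h⟩ := h
      match q, h with
      | [], h =>
        rw [nil_append, cons_prefix_cons] at h
        obtain ⟨rfl, t, rfl⟩ := h
        exact Or.inr (Or.inr ⟨rfl, rfl⟩)
      | [y], h =>
        rw [cons_append, cons_prefix_cons] at h
        obtain ⟨rfl, h⟩ := h
        rw [nil_append, cons_prefix_cons] at h
        obtain ⟨rfl, -⟩ := h
        exact Or.inl (infix_refl _)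
      | y :: z :: q, h =>
        rw [cons_append, cons_prefix_cons] at h
        obtain ⟨rfl, h⟩ := h
        rw [cons_append, cons_prefix_cons] at h
        obtain ⟨rfl, -⟩ := h
        exact Or.inl ⟨[], q ++ [b], by simp⟩
    · rcases ih h with h | h | h
      · exact Or.inl (h.trans (suffix_cons x _).isInfix)
      · exact Or.inr (Or.inl h)
      · exact Or.inr (Or.inr h)

/-- Discriminating paths are listed from `v0` towards `j`, so the first disagreement seen from `j`
is the last one in the list. -/
theorem exists_last_of_mem {l : List α} (P : α → Prop) {x : α} (hx : x ∈ l) (hP : P x) :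
    ∃ pre r post, l = pre ++ r :: post ∧ P r ∧ ∀ u ∈ post, ¬ P u := by
  induction l generalizing x with
  | nil => simp at hx
  | cons y l ih =>
    by_cases h : ∃ z ∈ l, P z
    · obtain ⟨z, hz, hPz⟩ := h
      obtain ⟨pre, r, post, rfl, hr, hpost⟩ := ih hz hPz
      exact ⟨y :: pre, r, post, rfl, hr, hpost⟩
    · push Not at h
      rcases mem_cons.1 hx with rfl | hx
      · exact ⟨[], x, l, rfl, hP, h⟩
      · exact absurd hP (h x hx)

end List

namespace DAG

variable {W : Type*} {D : DAG W} {Z : Set W}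

theorem not_adj_of_adj {u v : W} (h : D.Adj u v) : ¬ D.Adj v u := fun h' =>
  D.acyclic u (.tail (.single h) h')

theorem Skel.symm {u v : W} (h : D.Skel u v) : D.Skel v u := Or.symm h

namespace IsUnblocked

theorem of_infix {l l' : List W} (h : D.IsUnblocked Z l) (hl : l' <:+: l) :
    D.IsUnblocked Z l' where
  nodup := h.nodup.sublist hl.sublist
  chain := h.chain.infix hl
  collider a b c habc := h.collider a b c (habc.trans hl)
  noncollider a b c habc := h.noncollider a b c (habc.trans hl)

theorem reverse {l : List W} (h : D.IsUnblocked Z l) : D.IsUnblocked Z l.reverse where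
  nodup := List.nodup_reverse.2 h.nodup
  chain := List.isChain_reverse.2 (h.chain.imp fun _ _ => Skel.symm)
  collider a b c habc hcol :=
    h.collider c b a (by simpa using List.reverse_infix.2 habc) hcol.symm
  noncollider a b c habc hcol :=
    h.noncollider c b a (by simpa using List.reverse_infix.2 habc) fun h' => hcol h'.symm

/-- Two unblocked paths with only the vertex `b ∉ Z` in common can be joined at `b` if the second
one leaves `b` through an outgoing arrow. -/
theorem append {q s : List W} {b : W} (hq : D.IsUnblocked Z (q ++ [b]))
    (hs : D.IsUnblocked Z (b :: s)) (hb : b ∉ Z) (htail : ∀ x, s.head? = some x → D.Adj b x)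
    (hdisj : q.Disjoint s) : D.IsUnblocked Z (q ++ b :: s) where
  nodup := by
    have h1 := hq.nodup
    have h2 := hs.nodup
    rw [List.nodup_append'] at h1 ⊢
    refine ⟨h1.1, h2, fun x hx hx' => ?_⟩
    rcases List.mem_cons.1 hx' with rfl | hx'
    · exact h1.2.2 hx (List.mem_singleton_self _)
    · exact hdisj hx hx'
  chain := List.isChain_split.2 ⟨hq.chain, hs.chain⟩
  collider a c d h hcol := by
    rcases List.triple_infix_append_cons h with h | h | ⟨rfl, hd⟩
    · exact hq.collider _ _ _ h hcol
    · exact hs.collider _ _ _ h hcol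
    -- The arrow leaving `b` makes `b` a non-collider at the junction; `b ∉ Z` then keeps it open.
    · exact absurd hcol.2 (not_adj_of_adj (htail _ hd))
  noncollider a c d h hcol := by
    rcases List.triple_infix_append_cons h with h | h | ⟨rfl, -⟩
    · exact hq.noncollider _ _ _ h hcol
    · exact hs.noncollider _ _ _ h hcol
    · exact hb

theorem pair {u v : W} (h : D.Adj u v) : D.IsUnblocked Z [u, v] where
  nodup := by
    have : u ≠ v := by rintro rfl; exact not_adj_of_adj h h
    simpa using this
  chain := List.isChain_pair.2 (Or.inl h)
  collider a b c habc := by simpa using habc.length_le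
  noncollider a b c habc := by simpa using habc.length_le

end IsUnblocked

/-- d-connection extends along an arrow leaving an unconditioned vertex. -/
theorem DConnected.of_adj {a b x : W} (h : D.DConnected a b Z) (hb : b ∉ Z) (hbx : D.Adj b x) :
    D.DConnected a x Z := by
  obtain ⟨l, hhead, hlast, hl⟩ := h
  -- If the path already visits `x`, it is cut there; otherwise the arrow is appended.
  by_cases hx : x ∈ l
  · obtain ⟨l₁, l₂, rfl⟩ := List.append_of_mem hx
    refine ⟨l₁ ++ [x], ?_, by simp, hl.of_infix ⟨[], l₂, by simp⟩⟩
    cases l₁ <;> simpa using hhead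
  · obtain ⟨q, rfl⟩ := List.getLast?_eq_some_iff.1 hlast
    refine ⟨q ++ [b, x], ?_, by simp, ?_⟩
    · cases q <;> simpa using hhead
    · refine hl.append (.pair hbx) hb (by simpa using hbx) ?_
      rw [List.disjoint_singleton]
      exact fun h => hx (List.mem_append_left _ h)

/-- If `C` is d-connected to `j` by a path meeting an unblocked path from `r` to `j ∉ Z` only at
`j`, where the latter has a tail, then `C` is d-connected to `r`. -/
theorem DConnected.of_segment {C j r : W} {q s : List W} (hhead : q.head? = some C)
    (hlast : q.getLast? = some j) (hq : D.IsUnblocked Z q) (hj : j ∉ Z)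
    (hs : D.IsUnblocked Z (r :: s ++ [j])) (htail : ∀ x, (r :: s).getLast? = some x → D.Adj j x)
    (hmeet : ∀ u ∈ r :: s ++ [j], u ∈ q → u = j) : D.DConnected C r Z := by
  obtain ⟨q, rfl⟩ := List.getLast?_eq_some_iff.1 hlast
  -- Traversed backwards, the segment starts at `j` with an outgoing arrow, as `append` requires.
  have hs' : D.IsUnblocked Z (j :: (r :: s).reverse) := by simpa using hs.reverse
  refine ⟨q ++ j :: (r :: s).reverse, ?_,
    List.getLast?_eq_some_iff.2 ⟨q ++ j :: s.reverse, by simp⟩, hq.append hs' hj ?_ ?_⟩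
  · cases q <;> simpa using hhead
  · simpa only [List.head?_reverse] using htail
  · intro u hu hu'
    -- A shared vertex could only be `j`, which occurs in `q ++ [j]` only at the end.
    have hne := hq.nodup
    rw [List.nodup_append'] at hne
    obtain rfl := hmeet u (List.mem_append_left _ (List.mem_reverse.1 hu'))
      (List.mem_append_left _ hu)
    exact hne.2.2 hu (List.mem_singleton_self _)

end DAG

/-! ### Invariance and conditional independence of the regime -/

namespace MeasureTheory.Measure

variable {α β : Type*} [MeasurableSpace α] [MeasurableSpace β]

/-- The kernel ignores the tag `c`, so tagging before or after sampling from it gives the same law.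
-/
theorem map_prodMk_right_compProd_prodMkRight {γ : Type*} [MeasurableSpace γ] (ν : Measure α)
    [SFinite ν] (κ : Kernel α β) [IsSFiniteKernel κ] (c : γ) :
    (ν.map fun a => (a, c)) ⊗ₘ κ.prodMkRight γ = (ν ⊗ₘ κ).map fun p => ((p.1, c), p.2) := by
  ext s hs
  rw [compProd_apply hs, map_apply (by fun_prop) hs, compProd_apply (by measurability),
    lintegral_map (Kernel.measurable_kernel_prodMk_left hs) (by fun_prop)]
  rfl

/-- The components of a mixture of mutually singular copies of measures are determined by the
mixture. -/
theorem sum_smul_map_tag_inj {w : Fin 2 → ℝ≥0} (hw : ∀ c, 0 < w c)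
    {ρ ρ' : Fin 2 → Measure (α × β)}
    (h : ∑ c, w c • (ρ c).map (fun p => ((p.1, c), p.2)) =
      ∑ c, w c • (ρ' c).map (fun p => ((p.1, c), p.2))) (c : Fin 2) : ρ c = ρ' c := by
  -- On the slice with tag `c` all other components vanish; the remaining weight is positive and
  -- finite, so it cancels.
  have key : ∀ (ν : Fin 2 → Measure (α × β)) (s : Set (α × β)), MeasurableSet s →
      (∑ i, w i • (ν i).map (fun p => ((p.1, i), p.2)))
        {p : (α × Fin 2) × β | (p.1.1, p.2) ∈ s ∧ p.1.2 = c} = w c * ν c s := by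
    intro ν s hs
    have hm : MeasurableSet {p : (α × Fin 2) × β | (p.1.1, p.2) ∈ s ∧ p.1.2 = c} :=
      MeasurableSet.inter
        ((by fun_prop : Measurable fun p : (α × Fin 2) × β => (p.1.1, p.2)) hs)
        ((by fun_prop : Measurable fun p : (α × Fin 2) × β => p.1.2) (measurableSet_singleton c))
    rw [Measure.finsetSum_apply, Finset.sum_eq_single c]
    · rw [Measure.smul_apply, map_apply (by fun_prop) hm, ENNReal.smul_def, smul_eq_mul]
      simp
    · intro i _ hi
      rw [Measure.smul_apply, map_apply (by fun_prop) hm]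
      simp [hi]
    · simp
  ext s hs
  have h1 := key ρ s hs
  rw [h, key ρ' s hs] at h1
  exact ((ENNReal.mul_right_inj (by simpa using (hw c).ne') ENNReal.coe_ne_top).1 h1).symm

end MeasureTheory.Measure

namespace TwoRegimeSCM

variable {V : Type*} [Fintype V] {𝓧 : V → Type*} [∀ v, MeasurableSpace (𝓧 v)]

theorem map_mixture (m : TwoRegimeSCM V 𝓧) (w : Fin 2 → ℝ≥0) {β : Type*} [MeasurableSpace β]
    {φ : Fin 2 × ((v : V) → 𝓧 v) → β} (hφ : Measurable φ) :
    (m.mixture w).map φ = ∑ c, w c • (m.P c).map fun x => φ (c, x) := by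
  have h : ∀ c, ((Measure.dirac c).prod (m.P c)).map φ = (m.P c).map fun x => φ (c, x) := by
    intro c
    rw [Measure.dirac_prod, Measure.map_map hφ (by fun_prop)]
    rfl
  rw [mixture, Measure.map_add _ _ hφ, Measure.map_smul, Measure.map_smul, h, h,
    Fin.sum_univ_two]

/-- Both sides of the mixture identity are weighted sums of laws tagged by the regime, so they agree
exactly when the components do. -/
theorem map_mixture_eq_compProd_iff (m : TwoRegimeSCM V 𝓧) {w : Fin 2 → ℝ≥0}
    (hw : ∀ c, 0 < w c) (v : V) (Z : Finset V) (κ : Kernel ((w : Z) → 𝓧 w) (𝓧 v))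
    [IsMarkovKernel κ] :
    (m.mixture w).map (fun p => (((Z.restrict p.2 : (w : Z) → 𝓧 w), p.1), p.2 v)) =
        (m.mixture w).map (fun p => ((Z.restrict p.2 : (w : Z) → 𝓧 w), p.1)) ⊗ₘ
          κ.prodMkRight (Fin 2) ↔
      ∀ c, (m.P c).map (fun x => (Z.restrict x, x v)) = ((m.P c).map Z.restrict) ⊗ₘ κ := by
  have hl : (m.mixture w).map (fun p => (((Z.restrict p.2 : (w : Z) → 𝓧 w), p.1), p.2 v)) =
      ∑ c, w c • ((m.P c).map fun x => ((Z.restrict x : (w : Z) → 𝓧 w), x v)).map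
        (fun p => ((p.1, c), p.2)) := by
    rw [m.map_mixture w (by fun_prop)]
    refine Finset.sum_congr rfl fun c _ => ?_
    rw [Measure.map_map (by fun_prop) (by fun_prop)]
    rfl
  have hr : (m.mixture w).map (fun p => ((Z.restrict p.2 : (w : Z) → 𝓧 w), p.1)) ⊗ₘ
        κ.prodMkRight (Fin 2) =
      ∑ c, w c • (((m.P c).map Z.restrict) ⊗ₘ κ).map (fun p => ((p.1, c), p.2)) := by
    have h : ∀ c, (m.P c).map (fun x => ((Z.restrict x : (w : Z) → 𝓧 w), c)) =
        ((m.P c).map Z.restrict).map fun a => (a, c) := by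
      intro c
      rw [Measure.map_map (by fun_prop) (by fun_prop)]
      rfl
    rw [m.map_mixture w (by fun_prop)]
    simp only [h, Fin.sum_univ_two, ENNReal.smul_def]
    rw [Measure.compProd_add_left, Measure.compProd_smul_left, Measure.compProd_smul_left,
      Measure.map_prodMk_right_compProd_prodMkRight, Measure.map_prodMk_right_compProd_prodMkRight]
  rw [hl, hr]
  refine ⟨Measure.sum_smul_map_tag_inj hw, fun h => ?_⟩
  simp only [h]

/-- A tested conditional law is invariant iff the regime is conditionally independent of the
variable under the mixture. -/
theorem inv_iff_regimeCondIndep [∀ v, StandardBorelSpace (𝓧 v)] (m : TwoRegimeSCM V 𝓧)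
    {w : Fin 2 → ℝ≥0} (hw : ∀ c, 0 < w c) (v : V) (Z : Finset V) :
    m.Inv v Z ↔ m.RegimeCondIndep w v Z := by
  -- `condDistrib` needs a nonempty target, which the existence of a probability measure supplies.
  obtain ⟨x₀⟩ : Nonempty ((v : V) → 𝓧 v) := (m.P 0).nonempty_of_neZero
  have : Nonempty (𝓧 v) := ⟨x₀ v⟩
  have hk : Measurable
      (fun p : Fin 2 × ((v : V) → 𝓧 v) => (Z.restrict p.2 : (w : Z) → 𝓧 w)) := by fun_prop
  have hv : Measurable (fun p : Fin 2 × ((v : V) → 𝓧 v) => p.2 v) := by fun_prop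
  unfold RegimeCondIndep
  rw [condIndepFun_iff_condDistrib_prod_ae_eq_prodMkRight hv measurable_fst hk,
    condDistrib_ae_eq_iff_measure_eq_compProd _ hv.aemeasurable]
  constructor
  · rintro ⟨κ, hκ, h⟩
    have hκ' := (m.map_mixture_eq_compProd_iff hw v Z κ).2 h
    -- Forgetting the regime, `κ` also disintegrates the mixture, so it is almost everywhere the
    -- conditional law of `X_v` given `X_Z`.
    have hsum : (m.mixture w).map (fun p => ((Z.restrict p.2 : (w : Z) → 𝓧 w), p.2 v)) =
        (m.mixture w).map (fun p => (Z.restrict p.2 : (w : Z) → 𝓧 w)) ⊗ₘ κ := by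
      rw [m.map_mixture w (by fun_prop), m.map_mixture w hk]
      simp only [Fin.sum_univ_two, ENNReal.smul_def]
      rw [Measure.compProd_add_left, Measure.compProd_smul_left, Measure.compProd_smul_left,
        ← h 0, ← h 1]
    have hae := condDistrib_ae_eq_of_measure_eq_compProd _ hv.aemeasurable hsum
    rw [hκ']
    refine Measure.compProd_congr ?_
    -- The law of `X_Z` is a marginal of that of `(X_Z, C)`, so the almost everywhere equality
    -- lifts.
    have hfst : (m.mixture w).map (fun p => (Z.restrict p.2 : (w : Z) → 𝓧 w)) =
        ((m.mixture w).map (fun p => ((Z.restrict p.2 : (w : Z) → 𝓧 w), p.1))).map Prod.fst := by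
      rw [Measure.map_map measurable_fst (by fun_prop)]
      rfl
    rw [hfst] at hae
    filter_upwards [ae_of_ae_map measurable_fst.aemeasurable hae] with p hp
    rw [Kernel.prodMkRight_apply, Kernel.prodMkRight_apply, hp]
  -- The common kernel is the conditional law under the mixture.
  · exact fun h => ⟨_, inferInstance, (m.map_mixture_eq_compProd_iff hw v Z _).1 h⟩

end TwoRegimeSCM

/-! ### Soundness of the contrastive rules -/

section Soundness

variable {V : Type*} [Fintype V] {𝓧 : V → Type*} [∀ v, MeasurableSpace (𝓧 v)]
  {M : Set (TwoRegimeSCM V 𝓧)} {F : TestingFamily V} {𝒟 : Discovery V 𝓧}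
  {m m' : TwoRegimeSCM V 𝓧}

/-- Equal images share the observed outcome; this turns membership in the class into a concrete
model to which faithfulness applies. -/
theorem exists_model_of_mem_resClass (hm : m ∈ M) {G' : DAG V}
    (hG : G' ∈ resClass M F 𝒟 m.graph) :
    ∃ m' ∈ M, m'.graph = G' ∧ outcome F 𝒟 m' = outcome F 𝒟 m := by
  have h : outcome F 𝒟 m ∈ psiImage M F 𝒟 m.graph := ⟨m, hm, rfl, rfl⟩
  rwa [← show psiImage M F 𝒟 G' = psiImage M F 𝒟 m.graph from hG] at h

theorem reducedPsiImage_eq_image_fst (G : DAG V) :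
    reducedPsiImage M F 𝒟 G = Prod.fst '' psiImage M F 𝒟 G := by
  ext t
  constructor
  · rintro ⟨m, hm, hG, rfl⟩
    exact ⟨_, ⟨m, hm, hG, rfl⟩, rfl⟩
  · rintro ⟨_, ⟨m, hm, hG, rfl⟩, rfl⟩
    exact ⟨m, hm, hG, rfl⟩

theorem resClass_subset_reducedClass (G : DAG V) :
    resClass M F 𝒟 G ⊆ reducedClass M F 𝒟 G := fun G' h => by
  change reducedPsiImage M F 𝒟 G' = reducedPsiImage M F 𝒟 G
  rw [reducedPsiImage_eq_image_fst, reducedPsiImage_eq_image_fst,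
    show psiImage M F 𝒟 G' = psiImage M F 𝒟 G from h]

/-- Arrows common to a larger class are common to any smaller one. -/
theorem dirE_GtestReduced_subset (G : DAG V) :
    (GtestReduced M F 𝒟 G).DirE ⊆ (Gtest M F 𝒟 G).DirE :=
  fun _ he => ⟨he.1, fun D hD => he.2 D (resClass_subset_reducedClass G hD)⟩

theorem inv_iff_of_outcome_eq (h : outcome F 𝒟 m' = outcome F 𝒟 m) {v : V} {Z : Finset V}
    (hT : (v, Z) ∈ F.Ta) : m'.Inv v Z ↔ m.Inv v Z :=
  iff_of_eq (congrFun (congrArg Prod.snd h) ⟨(v, Z), hT⟩)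

variable [∀ v, StandardBorelSpace (𝓧 v)] {w : Fin 2 → ℝ≥0}

/-- Under regime faithfulness, models with the observed outcome have the d-separations from the
regime node given by the observed invariances. -/
theorem regimeDSep_iff_inv [DecidableEq V] (hw : ∀ c, 0 < w c) (hf : RegimeFaithful F 𝒟 w m')
    (h : outcome F 𝒟 m' = outcome F 𝒟 m) {v : V} {Z : Finset V}
    (hZ : TestedWitness F 𝒟 m v Z) : m'.RegimeDSep v Z ↔ m.Inv v Z := by
  -- Witness families depend only on the local PDAGs, so the observed witnesses are also witnesses
  -- for `m'`.
  have hloc : localPDAGs F 𝒟 m' = localPDAGs F 𝒟 m := congrArg Prod.fst h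
  rw [hf v Z hZ.1 (hloc ▸ hZ.2), ← m'.inv_iff_regimeCondIndep hw, inv_iff_of_outcome_eq h hZ.1]

/-- Between adjacent vertices with a common witness, a changing and an invariant one, the edge
points to the changing vertex. -/
theorem adj_of_inv_of_not_inv [DecidableEq V] (hw : ∀ c, 0 < w c)
    (hf : RegimeFaithful F 𝒟 w m') (h : outcome F 𝒟 m' = outcome F 𝒟 m) {i j : V} {Z : Finset V}
    (hi : TestedWitness F 𝒟 m i Z) (hj : TestedWitness F 𝒟 m j Z) (hij : m'.graph.Skel i j)
    (hinv : m.Inv i Z) (hchg : ¬ m.Inv j Z) : m'.graph.Adj i j := by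
  refine hij.resolve_right fun hji => ?_
  have hsep := (regimeDSep_iff_inv hw hf h hi).2 hinv
  have hcon := not_not.1 (mt (regimeDSep_iff_inv hw hf h hj).1 hchg)
  -- An arrow `j → i` would carry the d-connection from `C` to `j` on to `i`.
  refine hsep (hcon.of_adj ?_ hji)
  simpa using F.not_mem _ hj.1

variable [DecidableEq V]

/-- Without the mark `e`, some replay status must differ from `σ`. The disagreeing node nearest to
`j` would then be d-connected to `C`, although its tested conditional law is invariant. -/
theorem DPT.adj (hw : ∀ c, 0 < w c) (hm' : m' ∈ M) (hf : RegimeFaithful F 𝒟 w m')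
    (hres : m'.graph ∈ resClass M F 𝒟 m.graph) (h : outcome F 𝒟 m' = outcome F 𝒟 m)
    {S : F.Sa} {v0 : V} {p : List V} {j k : V} {R : Set V} {σ : V → Prop × Prop}
    {Z : Finset V} {e : V × V} (hD : DPT M F 𝒟 m S v0 p j k R σ Z e) :
    m'.graph.Adj e.1 e.2 := by
  by_contra hadj
  have hcompat : AmbientCompatible (knownMarks M F 𝒟 m S) (p ++ [j, k]) m'.graph :=
    ⟨hD.skel _ hres, fun e he => he.2.2 _ hres⟩
  have hbad : ∃ v ∈ R, pathStatus m'.graph (p ++ [j, k]) k v ≠ σ v := by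
    by_contra! hall
    exact hadj (hD.determined _ hcompat hall)
  obtain ⟨v, hvR, hv⟩ := hbad
  obtain ⟨pre, r, mid, hp, ⟨hrR, hr⟩, hmid⟩ := List.exists_last_of_mem
    (fun u => u ∈ R ∧ pathStatus m'.graph (p ++ [j, k]) k u ≠ σ u)
    (List.mem_of_mem_tail (hD.replay v hvR)) ⟨hvR, hv⟩
  obtain ⟨hseg, htail, hjZ, q, hhead, hlast, hq, hmeet⟩ :=
    hD.alternative m' hm' hres h hadj pre r mid hp hrR hr
      fun u hu huR => by_contra fun hne => hmid u hu ⟨huR, hne⟩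
  refine (regimeDSep_iff_inv hw hf h (hD.witness_replay r hrR)).2 (hD.inv r hrR) ?_
  refine DAG.DConnected.of_segment (s := mid.map some) hhead hlast hq (by simpa using hjZ)
    (by simpa using hseg) ?_ ?_
  -- The tail condition passes from the last vertex before `j` to its copy in the augmented graph.
  · intro x hx
    rw [← List.map_cons, List.getLast?_map, Option.map_eq_some_iff] at hx
    obtain ⟨y, hy, rfl⟩ := hx
    obtain ⟨l, hl⟩ := List.getLast?_eq_some_iff.1 hy
    exact htail y ⟨l, by rw [hl]; simp⟩
  · intro u hu huq
    have hu' : u ∈ (r :: mid ++ [j]).map some := by simpa using hu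
    obtain ⟨y, hy, rfl⟩ := List.mem_map.1 hu'
    rw [hmeet y hy huq]

/-- Every orientation output by a contrastive rule is compelled in the restricted class. -/
theorem Krules_subset_dirE_Gtest (hw : ∀ c, 0 < w c)
    (hfaithful : ∀ m' ∈ M, RegimeFaithful F 𝒟 w m') (hm : m ∈ M) :
    Krules M F 𝒟 m ⊆ (Gtest M F 𝒟 m.graph).DirE := by
  intro e he
  have hadj : ∀ G' ∈ resClass M F 𝒟 m.graph, G'.Adj e.1 e.2 := by
    intro G' hG'
    obtain ⟨m', hm', rfl, hout⟩ := exists_model_of_mem_resClass hm hG'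
    have hf := hfaithful m' hm'
    obtain ⟨S, hS⟩ := Set.mem_iUnion.1 he
    rcases hS with (hS | ⟨i, j, k, hS, rfl | rfl⟩) | ⟨v0, p, j, k, R, σ, Z, hS⟩
    · exact adj_of_inv_of_not_inv hw hf hout hS.witness_i hS.witness_j (hS.skel _ hG') hS.inv
        hS.chg
    · exact adj_of_inv_of_not_inv hw hf hout hS.witness_i hS.witness_j (hS.skel_ij _ hG') hS.inv_i
        hS.chg
    · exact adj_of_inv_of_not_inv hw hf hout hS.witness_k hS.witness_j (hS.skel_jk _ hG').symm
        hS.inv_k hS.chg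
    · exact hS.adj hw hm' hf hG' hout
  -- The endpoints differ because `m.graph` belongs to its own class and has no loops.
  refine ⟨fun heq => ?_, hadj⟩
  have := hadj m.graph rfl
  rw [heq] at this
  exact m.graph.acyclic _ (.single this)

end Soundness

/-! ### Monotonicity of the Meek closure -/

namespace PDAG

variable {W : Type*} {H : PDAG W} {K K' : Set (W × W)}

/-- The negative side conditions of the rules refer to `H` alone, never to arrows derived from `K`,
so each derivation can be replayed with more knowledge. -/
theorem MeekArrow.mono (hK : K ⊆ K') {u v : W} (h : H.MeekArrow K u v) : H.MeekArrow K' u v := by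
  induction h with
  | base h => exact .base h
  | knowledge h h' => exact .knowledge (hK h) h'
  | rule1 _ h h' h'' ih => exact .rule1 ih h h' h''
  | rule2 _ _ h ih ih' => exact .rule2 ih ih' h
  | rule3 h1 h2 h3 _ _ h4 h5 ih ih' => exact .rule3 h1 h2 h3 ih ih' h4 h5
  | rule4 h1 h2 h3 _ _ h4 h5 ih ih' => exact .rule4 h1 h2 h3 ih ih' h4 h5

theorem dirE_subset_mpdag : H.DirE ⊆ (H.mpdag K).DirE := fun _ h => MeekArrow.base h

theorem dirE_mpdag_mono (hK : K ⊆ K') : (H.mpdag K).DirE ⊆ (H.mpdag K').DirE :=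
  fun _ h => MeekArrow.mono hK h

end PDAG

theorem theorem1 {V : Type*} [Fintype V] [DecidableEq V] {𝓧 : V → Type*}
    [∀ v, MeasurableSpace (𝓧 v)] [∀ v, StandardBorelSpace (𝓧 v)]
    (M : Set (TwoRegimeSCM V 𝓧)) (F : TestingFamily V) (𝒟 : Discovery V 𝓧)
    (w : Fin 2 → ℝ≥0) (hw : ∀ c, 0 < w c) (hw1 : w 0 + w 1 = 1)
    (hfaithful : ∀ m' ∈ M, RegimeFaithful F 𝒟 w m')
    (m : TwoRegimeSCM V 𝓧) (hm : m ∈ M) (Hobs : PDAG V)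
    (hclosure : ClosureSound Hobs (Gtest M F 𝒟 m.graph))
    (hper : (Hper M F 𝒟 m Hobs).DirE ⊆ (GtestReduced M F 𝒟 m.graph).DirE) :
    (Hobs.DirE ⊆ (Hper M F 𝒟 m Hobs).DirE ∧
      (Hper M F 𝒟 m Hobs).DirE ⊆ (Hctr M F 𝒟 m Hobs).DirE) ∧
    (Hctr M F 𝒟 m Hobs).DirE ⊆ (Gtest M F 𝒟 m.graph).DirE ∧
    ((contrastivelyCompelled M F 𝒟 m.graph).Nonempty →
      (∀ A : LocalPDAGs F → PDAG V,
        NonContrastive A (localPDAGs F 𝒟 m) (Hper M F 𝒟 m Hobs) →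
        (A (localPDAGs F 𝒟 m)).DirE ⊂ (Gtest M F 𝒟 m.graph).DirE) ∧
      (Hper M F 𝒟 m Hobs).DirE ⊂ (Gtest M F 𝒟 m.graph).DirE) := by
  have hred := dirE_GtestReduced_subset (M := M) (F := F) (𝒟 := 𝒟) m.graph
  have hobs : Hobs.DirE ⊆ (Hper M F 𝒟 m Hobs).DirE := PDAG.dirE_subset_mpdag
  refine ⟨⟨hobs, PDAG.dirE_mpdag_mono Set.subset_union_left⟩,
    hclosure _ ((hobs.trans hper).trans hred)
      (Set.union_subset hred (Krules_subset_dirE_Gtest hw hfaithful hm)), ?_⟩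
  rintro ⟨e, he, he'⟩
  have hlt : (Hper M F 𝒟 m Hobs).DirE ⊂ (Gtest M F 𝒟 m.graph).DirE :=
    -- Any edge of `R` witnesses strictness, since `Hper` stays inside the reduced graph.
    (Set.ssubset_iff_of_subset (hper.trans hred)).2 ⟨e, he, fun h => he' (hper h)⟩
  exact ⟨fun A hA => hA.dirE_subset.trans_ssubset hlt, hlt⟩
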